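/- **Burning number.** Let $G$ be a finite simple graph. At round $0$ all vertices are unburned. In each round $t\ge 1$ one vertex $x_t$ that was unburned at the end of round $t-1$ is chosen and becomes burned, and all neighbours of the vertices burned by the end of round $t-1$ become burned as well; burned vertices stay burned, and the process ends when all vertices are burned. The burning number $b(G)$ is the least $k$ such that all vertices of $G$ can be burned within $k$ rounds. **The graphs.** For integers $g\ge 3$ and $a_1\ge a_2\ge 1$ let $U_g^{a_1,a_2}$ be the graph of order $n=g+a_1+a_2$ obtained from a cycle $v_1v_2\cdots v_gv_1$ by attaching at the vertex $v_g$ two paths of lengths $a_1$ and $a_2$ (that is, with $a_1$ and $a_2$ new vertices). **Exceptional triples.** For integers $q,r$ put $\mathcal B=\{(2q-2,q^2-q-2,q+1),(2q-1,q^2-q-2,q+1)\}$; $B_1=\{(q^2-2,q,q),(q^2-6,q+2,q+2),(q^2-10,q+4,q+4),(q^2-3,q+1,q),(q^2-5,q+3,q),(q^2-7,q+3,q+2),(q^2-8,q+3,q+3),(q^2-7,q+5,q),(q^2-10,q+5,q+3),(q^2-11,q+5,q+4),(q^2-12,q+5,q+5),(q^2-14,q+6,q+6),(q^2-12,q+7,q+3),(q^2-14,q+7,q+5),(q^2-14,q+9,q+3)\}$;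 $B_2=\{(2q,q^2-q-2,q),(2q+2,q^2-q-6,q+2),(2q+4,q^2-q-10,q+4),(2q+1,q^2-q-3,q),(2q+3,q^2-q-5,q),(2q+3,q^2-q-7,q+2),(2q+3,q^2-q-8,q+3),(2q+5,q^2-q-7,q),(2q+5,q^2-q-10,q+3),(2q+5,q^2-q-11,q+4),(2q+5,q^2-q-12,q+5),(2q+6,q^2-q-14,q+6),(2q+7,q^2-q-12,q+3),(2q+7,q^2-q-14,q+5),(2q+9,q^2-q-14,q+3)\}$; $B_3=\{(2q,q^2-q-3,q+1),(2q,q^2-q-5,q+3),(2q+2,q^2-q-7,q+3),(2q,q^2-q-7,q+5),(2q+3,q^2-q-10,q+5),(2q+4,q^2-q-11,q+5),(2q+3,q^2-q-12,q+7),(2q+5,q^2-q-14,q+7),(2q+3,q^2-q-14,q+9)\}$; $B_4=\{(24,16,6),(22,16,8),(35,19,7),(32,19,10),(30,19,12),(28,19,14),(26,19,16),(30,21,10),(28,21,12),(45,22,11),(43,22,13),(41,22,15),(34,22,22),(43,24,11),(41,24,13),(32,24,22),(41,26,11),(60,25,12),(58,25,14),(47,25,25),(58,27,12),(47,38,12),(77,28,13)\}$;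 $B_5=\{(22,18,6),(22,16,8),(26,28,7),(26,25,10),(26,23,12),(26,21,14),(26,19,16),(28,23,10),(28,21,12),(30,37,11),(30,35,13),(30,33,15),(30,26,22),(32,35,11),(32,33,13),(32,24,22),(34,33,11),(34,51,12),(34,49,14),(34,38,25),(36,49,12),(47,38,12),(38,67,13)\}$; $B_6=\{(12,18,16),(14,16,16),(14,28,19),(17,25,19),(19,23,19),(21,21,19),(23,19,19),(17,23,21),(19,21,21),(19,37,22),(21,35,22),(23,33,22),(30,26,22),(19,35,24),(21,33,24),(30,24,24),(19,33,26),(21,51,25),(23,49,25),(34,38,25),(21,49,27),(21,38,38),(23,67,28)\}$; $\mathcal C_1=\{(2q+1,q^2-q-2,r-q+1),(q^2-2,q+1,r-q+1)\}$; $\mathcal C_2=\{(q^2-7,q+2,q+1),(2q+1,q^2-q-6,q+1),(2q+1,q^2-q-7,q+2)\}$; $\mathcal C_3=\{(q^2-3,q,q),(q^2-5,q+1,q+1),(q^2-6,q+2,q+1),(q^2-7,q+2,q+2),(q^2-7,q+3,q+1),(q^2-11,q+4,q+4),(2q+4,q^2-q-11,q+4),(2q+1,q^2-q-5,q+1),(2q+1,q^2-q-6,q+2),(2q+1,q^2-q-7,q+3),(2q+2,q^2-q-6,q+1),(2q+2,q^2-q-7,q+2),(2q+3,q^2-q-7,q+1),(2q,q^2-q-3,q),(22,16,7),(13,16,16)\}$;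 $\mathcal C_4=\{(g,a_1,a_2): g+a_1+a_2=q^2+2q-2,\ g-q\ge a_1\ge a_2=q+1\}\cup B_1\cup B_4$; $\mathcal C_5=\{(g,a_1,a_2): g+a_1+a_2=q^2+2q-2,\ a_1\ge g-q\ge a_2=q+1\}\cup B_2\cup B_5$; $\mathcal C_6=\{(g,a_1,a_2): g+a_1+a_2=q^2+2q-2,\ a_1\ge a_2\ge g-q=q+1\}\cup B_3\cup B_6$. **Theorem.** Let $g\ge 3$ and $a_1\ge a_2\ge 1$, and write the order of $U_g^{a_1,a_2}$ as $n=g+a_1+a_2=q^2+r$ with integers $q\ge 0$ and $1\le r\le 2q+1$. Suppose that at least one of the following holds: 1. $r\ge 2q-1$; 2. $3\le g\le r$; 3. $g\ge q^2+1$; 4. $a_1\ge q^2-\lfloor g/2\rfloor$; 5. $2q\le g\le q^2$ and $a_2\le r-q$; 6. $(g,a_1,a_2)\in \mathcal C_1\cup\mathcal C_2\cup\mathcal C_3\cup\mathcal C_4\cup\mathcal C_5\cup\mathcal C_6\cup\mathcal B$. Then $b(U_g^{a_1,a_2})=\lceil\sqrt n\,\rceil=q+1$. -/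

import Mathlib

namespace GraphBurning

/-! ### Graph burning -/

section Burning

variable {V : Type*} (G : SimpleGraph V)

/-- The set of vertices that are burned after `t` rounds, when `x 0, x 1, …` are the vertices chosen
in rounds `1, 2, …`: in round `t + 1` the fire spreads to the neighbours of the vertices burned so
far, and the vertex `x t` is set on fire. -/
def burnedAfter {k : ℕ} (x : Fin k → V) : ℕ → Set V
  | 0 => ∅
  | t + 1 => {v | v ∈ burnedAfter x t ∨ (∃ u ∈ burnedAfter x t, G.Adj u v) ∨
      ∃ h : t < k, v = x ⟨t, h⟩}

/-- `x` is a burning sequence of `G`: every chosen vertex is unburned when it is chosen, and all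
vertices are burned at the end of the last round. -/
def IsBurningSequence {k : ℕ} (x : Fin k → V) : Prop :=
  (∀ i : Fin k, x i ∉ burnedAfter G x i) ∧ burnedAfter G x k = Set.univ

/-- `G` can be burned in at most `k` rounds. -/
def IsBurnable (k : ℕ) : Prop :=
  ∃ j ≤ k, ∃ x : Fin j → V, IsBurningSequence G x

/-- The burning number of `G`. -/
noncomputable def burningNumber : ℕ := sInf {k | IsBurnable G k}

end Burning

/-! ### The unicyclic graphs with two arms -/

/-- The graph `U_g^{a₁,a₂}`: a cycle `v_1 ⋯ v_g` (its vertices are the elements of `Fin g`, the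
vertex `v_i` being the element `i - 1`) with two paths of `a₁` and `a₂` new vertices attached by
their first vertices to the vertex `v_g`. -/
def twoArmUnicyclic (g a₁ a₂ : ℕ) : SimpleGraph (Fin g ⊕ Fin a₁ ⊕ Fin a₂) :=
  SimpleGraph.fromRel fun x y =>
    match x, y with
    | .inl i, .inl j => (SimpleGraph.cycleGraph g).Adj i j
    | .inr (.inl i), .inr (.inl j) => (SimpleGraph.pathGraph a₁).Adj i j
    | .inr (.inr i), .inr (.inr j) => (SimpleGraph.pathGraph a₂).Adj i j
    | .inl i, .inr (.inl j) => i.val + 1 = g ∧ j.val = 0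
    | .inl i, .inr (.inr j) => i.val + 1 = g ∧ j.val = 0
    | _, _ => False

/-! ### The exceptional sets of triples `(g, a₁, a₂)` -/

def setB (q : ℤ) : Set (ℤ × ℤ × ℤ) :=
  {(2*q-2, q^2-q-2, q+1), (2*q-1, q^2-q-2, q+1)}

def setB₁ (q : ℤ) : Set (ℤ × ℤ × ℤ) :=
  {(q^2-2, q, q), (q^2-6, q+2, q+2), (q^2-10, q+4, q+4), (q^2-3, q+1, q),
   (q^2-5, q+3, q), (q^2-7, q+3, q+2), (q^2-8, q+3, q+3), (q^2-7, q+5, q),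
   (q^2-10, q+5, q+3), (q^2-11, q+5, q+4), (q^2-12, q+5, q+5), (q^2-14, q+6, q+6),
   (q^2-12, q+7, q+3), (q^2-14, q+7, q+5), (q^2-14, q+9, q+3)}

def setB₂ (q : ℤ) : Set (ℤ × ℤ × ℤ) :=
  {(2*q, q^2-q-2, q), (2*q+2, q^2-q-6, q+2), (2*q+4, q^2-q-10, q+4), (2*q+1, q^2-q-3, q),
   (2*q+3, q^2-q-5, q), (2*q+3, q^2-q-7, q+2), (2*q+3, q^2-q-8, q+3), (2*q+5, q^2-q-7, q),
   (2*q+5, q^2-q-10, q+3), (2*q+5, q^2-q-11, q+4), (2*q+5, q^2-q-12, q+5),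
   (2*q+6, q^2-q-14, q+6), (2*q+7, q^2-q-12, q+3), (2*q+7, q^2-q-14, q+5),
   (2*q+9, q^2-q-14, q+3)}

def setB₃ (q : ℤ) : Set (ℤ × ℤ × ℤ) :=
  {(2*q, q^2-q-3, q+1), (2*q, q^2-q-5, q+3), (2*q+2, q^2-q-7, q+3), (2*q, q^2-q-7, q+5),
   (2*q+3, q^2-q-10, q+5), (2*q+4, q^2-q-11, q+5), (2*q+3, q^2-q-12, q+7),
   (2*q+5, q^2-q-14, q+7), (2*q+3, q^2-q-14, q+9)}

def setB₄ : Set (ℤ × ℤ × ℤ) :=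
  {(24,16,6), (22,16,8), (35,19,7), (32,19,10), (30,19,12), (28,19,14),
   (26,19,16), (30,21,10), (28,21,12), (45,22,11), (43,22,13), (41,22,15),
   (34,22,22), (43,24,11), (41,24,13), (32,24,22), (41,26,11), (60,25,12),
   (58,25,14), (47,25,25), (58,27,12), (47,38,12), (77,28,13)}

def setB₅ : Set (ℤ × ℤ × ℤ) :=
  {(22,18,6), (22,16,8), (26,28,7), (26,25,10), (26,23,12), (26,21,14),
   (26,19,16), (28,23,10), (28,21,12), (30,37,11), (30,35,13), (30,33,15),
   (30,26,22), (32,35,11), (32,33,13), (32,24,22), (34,33,11), (34,51,12),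
   (34,49,14), (34,38,25), (36,49,12), (47,38,12), (38,67,13)}

def setB₆ : Set (ℤ × ℤ × ℤ) :=
  {(12,18,16), (14,16,16), (14,28,19), (17,25,19), (19,23,19), (21,21,19),
   (23,19,19), (17,23,21), (19,21,21), (19,37,22), (21,35,22), (23,33,22),
   (30,26,22), (19,35,24), (21,33,24), (30,24,24), (19,33,26), (21,51,25),
   (23,49,25), (34,38,25), (21,49,27), (21,38,38), (23,67,28)}

def setC₁ (q r : ℤ) : Set (ℤ × ℤ × ℤ) :=
  {(2*q+1, q^2-q-2, r-q+1), (q^2-2, q+1, r-q+1)}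

def setC₂ (q : ℤ) : Set (ℤ × ℤ × ℤ) :=
  {(q^2-7, q+2, q+1), (2*q+1, q^2-q-6, q+1), (2*q+1, q^2-q-7, q+2)}

def setC₃ (q : ℤ) : Set (ℤ × ℤ × ℤ) :=
  {(q^2-3, q, q), (q^2-5, q+1, q+1), (q^2-6, q+2, q+1), (q^2-7, q+2, q+2),
   (q^2-7, q+3, q+1), (q^2-11, q+4, q+4), (2*q+4, q^2-q-11, q+4),
   (2*q+1, q^2-q-5, q+1), (2*q+1, q^2-q-6, q+2), (2*q+1, q^2-q-7, q+3),
   (2*q+2, q^2-q-6, q+1), (2*q+2, q^2-q-7, q+2), (2*q+3, q^2-q-7, q+1),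
   (2*q, q^2-q-3, q), (22,16,7), (13,16,16)}

def setC₄ (q : ℤ) : Set (ℤ × ℤ × ℤ) :=
  {(g, a₁, a₂) | g + a₁ + a₂ = q^2+2*q-2 ∧ g - q ≥ a₁ ∧ a₁ ≥ a₂ ∧ a₂ = q+1} ∪ setB₁ q ∪ setB₄

def setC₅ (q : ℤ) : Set (ℤ × ℤ × ℤ) :=
  {(g, a₁, a₂) | g + a₁ + a₂ = q^2+2*q-2 ∧ a₁ ≥ g - q ∧ g - q ≥ a₂ ∧ a₂ = q+1} ∪ setB₂ q ∪ setB₅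

def setC₆ (q : ℤ) : Set (ℤ × ℤ × ℤ) :=
  {(g, a₁, a₂) | g + a₁ + a₂ = q^2+2*q-2 ∧ a₁ ≥ a₂ ∧ a₂ ≥ g - q ∧ g - q = q+1} ∪ setB₃ q ∪ setB₆

end GraphBurning

open GraphBurning

/-! A graph can be burned in `k` rounds iff it is covered by balls of radii `0, …, k - 1`.

Upper bound: deleting a cycle edge at the branching vertex leaves a spider with three legs, and such
a spider with at most `k ^ 2` vertices can be burned in `k` rounds: while the longest leg is long
enough, the largest ball is used up on its end.

Lower bound: in a cover by balls of radii `0, …, q - 1`, let `s` be the largest radius for which the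
ball around the branching vertex is contained in one of the balls. What lies outside of it falls
into three paths, and each ball of the cover meets only one of them, in at most `2 * ρ + 1` vertices
if its radius is `ρ`. Hence the remainders of the two arms and of the cycle have to be exhausted by
sums of distinct odd numbers over disjoint sets of radii. In most cases there are not enough
vertices for this in total; the exceptional triples are those where the total would suffice but the
required sums cannot be formed. -/

namespace GraphBurning

section BallCovers

variable {V : Type*} {G : SimpleGraph V}

theorem edist_le_coe_iff {u v : V} {n : ℕ} :
    G.edist u v ≤ n ↔ ∃ w : G.Walk u v, w.length ≤ n := by
  refine ⟨fun h => ?_, fun ⟨w, hw⟩ => (SimpleGraph.edist_le w).trans (by exact_mod_cast hw)⟩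
  obtain ⟨w, hw⟩ := SimpleGraph.exists_walk_of_edist_ne_top (ne_top_of_le_ne_top (by simp) h)
  exact ⟨w, by rw [← hw] at h; exact_mod_cast h⟩

theorem edist_le_succ_of_adj {u v w : V} {n : ℕ} (h : G.edist u v ≤ n) (hvw : G.Adj v w) :
    G.edist u w ≤ (n + 1 : ℕ) := by
  obtain ⟨p, hp⟩ := edist_le_coe_iff.1 h
  exact edist_le_coe_iff.2 ⟨p.concat hvw, by simpa using hp⟩

theorem le_add_of_edist_le {f : V → ℕ} (hf : ∀ u v, G.Adj u v → f v ≤ f u + 1) {u v : V} {n : ℕ}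
    (h : G.edist u v ≤ n) : f v ≤ f u + n := by
  obtain ⟨w, hw⟩ := edist_le_coe_iff.1 h
  refine le_trans ?_ (Nat.add_le_add_left hw _)
  clear h hw
  induction w with
  | nil => simp
  | cons huv w ih =>
    have := hf _ _ huv
    rw [SimpleGraph.Walk.length_cons]
    omega

theorem exists_edist_le_of_mem_burnedAfter {j t : ℕ} {x : Fin j → V} {v : V}
    (hv : v ∈ burnedAfter G x t) : ∃ (i : Fin j) (ρ : ℕ), i + ρ + 1 = t ∧ G.edist (x i) v ≤ ρ := by
  induction t generalizing v with
  | zero => exact hv.elim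
  | succ t ih =>
    rcases hv with hv | ⟨u, hu, huv⟩ | ⟨ht, rfl⟩
    · obtain ⟨i, ρ, hρ, h⟩ := ih hv
      exact ⟨i, ρ + 1, by omega, h.trans (by exact_mod_cast ρ.le_succ)⟩
    · obtain ⟨i, ρ, hρ, h⟩ := ih hu
      exact ⟨i, ρ + 1, by omega, edist_le_succ_of_adj h huv⟩
    · exact ⟨⟨t, ht⟩, 0, by simp, by simp⟩

theorem mem_burnedAfter_add {j t m : ℕ} {x : Fin j → V} {u v : V} (hu : u ∈ burnedAfter G x t)
    (h : G.edist u v ≤ m) : v ∈ burnedAfter G x (t + m) := by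
  have mono (u s n) (hu : u ∈ burnedAfter G x s) : u ∈ burnedAfter G x (s + n) := by
    induction n with
    | zero => exact hu
    | succ n ih => exact Or.inl ih
  obtain ⟨w, hw⟩ := edist_le_coe_iff.1 h
  obtain ⟨n, rfl⟩ := Nat.exists_eq_add_of_le hw
  clear h hw
  induction w generalizing t with
  | nil => exact mono _ _ _ hu
  | cons huv w ih =>
    have := ih (t := t + 1) (Or.inr (Or.inl ⟨_, hu, huv⟩))
    rwa [show t + 1 + (w.length + n) = t + (w.length + 1 + n) by omega] at this

theorem burnedAfter_snoc {t : ℕ} (x : Fin t → V) (v : V) {s : ℕ} (hs : s ≤ t) :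
    burnedAfter G (Fin.snoc x v : Fin (t + 1) → V) s = burnedAfter G x s := by
  induction s with
  | zero => rfl
  | succ s ih =>
    have hs' : s < t := hs
    ext u
    simp [burnedAfter, ih hs'.le, hs', hs'.le, Fin.snoc]

theorem IsBurnable.mono {k l : ℕ} (h : IsBurnable G k) (hkl : k ≤ l) : IsBurnable G l :=
  let ⟨j, hj, hx⟩ := h
  ⟨j, hj.trans hkl, hx⟩

/-- A vertex `c t` that is already burned in round `t + 1` may not be chosen; it is replaced by an
arbitrary unburned one. -/
theorem isBurnable_or_exists_legal (c : ℕ → V) (t : ℕ) : IsBurnable G t ∨ ∃ x : Fin t → V,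
    ∀ i : Fin t, x i ∉ burnedAfter G x i ∧ c i ∈ burnedAfter G x (i + 1) := by
  induction t with
  | zero => exact Or.inr ⟨Fin.elim0, fun i => i.elim0⟩
  | succ t ih =>
    obtain hb | ⟨x, hx⟩ := ih
    · exact Or.inl (hb.mono t.le_succ)
    by_cases huniv : burnedAfter G x t = Set.univ
    · exact Or.inl ⟨t, t.le_succ, x, fun i => (hx i).1, huniv⟩
    obtain ⟨v, hv, hcv⟩ : ∃ v ∉ burnedAfter G x t, c t ∈ burnedAfter G x t ∨ c t = v := by
      by_cases hc : c t ∈ burnedAfter G x t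
      · obtain ⟨v, hv⟩ := (Set.ne_univ_iff_exists_notMem _).1 huniv
        exact ⟨v, hv, Or.inl hc⟩
      · exact ⟨c t, hc, Or.inr rfl⟩
    refine Or.inr ⟨Fin.snoc x v, fun i => ?_⟩
    induction i using Fin.lastCases with
    | last =>
      have hlast : burnedAfter G (Fin.snoc x v : Fin (t + 1) → V) t = burnedAfter G x t :=
        burnedAfter_snoc x v le_rfl
      rw [Fin.snoc_last, Fin.val_last]
      refine ⟨hlast ▸ hv, ?_⟩
      rcases hcv with hc | hc
      · exact Or.inl (hlast.symm ▸ hc)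
      · exact Or.inr (Or.inr ⟨t.lt_succ_self, hc.trans (Fin.snoc_last (α := fun _ => V) v x).symm⟩)
    | cast i =>
      simpa [burnedAfter_snoc x v i.2.le, burnedAfter_snoc x v i.2] using hx i

theorem isBurnable_iff_exists_cover [Nonempty V] {k : ℕ} :
    IsBurnable G k ↔ ∃ c : ℕ → V, ∀ v, ∃ ρ < k, G.edist (c ρ) v ≤ ρ := by
  constructor
  · rintro ⟨j, hj, x, -, hx⟩
    refine ⟨fun ρ => if h : j - 1 - ρ < j then x ⟨j - 1 - ρ, h⟩ else Classical.arbitrary V,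
      fun v => ?_⟩
    obtain ⟨i, ρ, hρ, h⟩ := exists_edist_le_of_mem_burnedAfter (hx.symm ▸ Set.mem_univ v)
    have hi : j - 1 - ρ = i := by omega
    exact ⟨ρ, by omega, by simpa [hi] using h⟩
  · rintro ⟨c, hc⟩
    obtain hb | ⟨x, hx⟩ := isBurnable_or_exists_legal (G := G) (fun t => c (k - 1 - t)) k
    · exact hb
    refine ⟨k, le_rfl, x, fun i => (hx i).1, Set.eq_univ_of_forall fun v => ?_⟩
    obtain ⟨ρ, hρ, h⟩ := hc v
    have hmem := (hx ⟨k - 1 - ρ, by omega⟩).2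
    simp only [show k - 1 - (k - 1 - ρ) = ρ by omega] at hmem
    have := mem_burnedAfter_add hmem h
    rwa [show k - 1 - ρ + 1 + ρ = k by omega] at this

theorem burningNumber_eq_succ {k : ℕ} (hlower : ¬ IsBurnable G k) (hupper : IsBurnable G (k + 1)) :
    burningNumber G = k + 1 := by
  refine le_antisymm (Nat.sInf_le hupper) (le_csInf ⟨_, hupper⟩ fun l hl => ?_)
  by_contra! hlt
  exact hlower (hl.mono (Nat.lt_succ_iff.1 hlt))

end BallCovers

section Spider

variable {ι : Type*} [DecidableEq ι] {k : ℕ} {ℓ ℓ' : ι → ℕ}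

/-- The distance in a spider, whose vertex at distance `d` from the head on the leg `i` is `(i, d)`;
all pairs `(i, 0)` stand for the head. -/
def spiderDist (u v : ι × ℕ) : ℕ :=
  if u.1 = v.1 then Nat.dist u.2 v.2 else u.2 + v.2

/-- The spider with legs of lengths `ℓ i` is covered by balls of radii `0, …, k - 1`, the ball of
radius `ρ` being centred at `c ρ`. A centre may lie beyond the end of its leg. -/
def SpiderCoverable (k : ℕ) (ℓ : ι → ℕ) : Prop :=
  ∃ c : ℕ → ι × ℕ, ∀ i, ∀ d ≤ ℓ i, ∃ ρ < k, spiderDist (c ρ) (i, d) ≤ ρ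

theorem SpiderCoverable.mono (h : SpiderCoverable k ℓ') (hℓ : ℓ ≤ ℓ') : SpiderCoverable k ℓ :=
  let ⟨c, hc⟩ := h
  ⟨c, fun i d hd => hc i d (hd.trans (hℓ i))⟩

theorem SpiderCoverable.of_comp_equiv (σ : Equiv.Perm ι) (h : SpiderCoverable k (ℓ ∘ σ)) :
    SpiderCoverable k ℓ := by
  obtain ⟨c, hc⟩ := h
  refine ⟨fun ρ => (σ (c ρ).1, (c ρ).2), fun i d hd => ?_⟩
  obtain ⟨ρ, hρ, h⟩ := hc (σ.symm i) d (by simpa using hd)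
  exact ⟨ρ, hρ, by simpa [spiderDist, Equiv.eq_symm_apply] using h⟩

theorem SpiderCoverable.extend_leg (h : SpiderCoverable k ℓ) (i : ι) :
    SpiderCoverable (k + 1) (Function.update ℓ i (ℓ i + (2 * k + 1))) := by
  obtain ⟨c, hc⟩ := h
  refine ⟨Function.update c k (i, ℓ i + 1 + k), fun j d hd => ?_⟩
  by_cases hd' : d ≤ ℓ j
  · obtain ⟨ρ, hρ, h⟩ := hc j d hd'
    exact ⟨ρ, by omega, by simpa [hρ.ne] using h⟩
  · obtain rfl : j = i := by
      by_contra hne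
      exact hd' (by simpa [hne] using hd)
    simp only [Function.update_self] at hd
    refine ⟨k, k.lt_succ_self, ?_⟩
    simp only [Function.update_self, spiderDist, if_true, Nat.dist]
    omega

/-- The largest ball is centred at the head, the next three are centred on one leg each. -/
theorem spiderCoverable_of_six_le (hk : 6 ≤ k) :
    SpiderCoverable k (fun _ : Fin 3 => 2 * k - 2) := by
  refine ⟨fun ρ => if ρ + 1 = k then (0, 0) else
    (if ρ + 2 = k then 0 else if ρ + 3 = k then 1 else 2, k + ρ), fun i d hd => ?_⟩
  replace hd : d ≤ 2 * k - 2 := hd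
  by_cases hdk : d < k
  · refine ⟨k - 1, by omega, ?_⟩
    beta_reduce
    rw [if_pos (by omega), spiderDist]
    simp only [Nat.dist]
    split_ifs <;> omega
  · have hi := i.2
    refine ⟨k - 2 - i, by omega, ?_⟩
    have hleg : (if k - 2 - i + 2 = k then 0 else if k - 2 - i + 3 = k then 1 else 2) = i := by
      fin_cases i <;> simp only [] <;> split_ifs <;> first | rfl | omega
    beta_reduce
    rw [if_neg (by omega), hleg, spiderDist, if_pos rfl]
    simp only [Nat.dist]
    omega

theorem spiderCoverable_of_le_five {ℓ : Fin 3 → ℕ} (hk : k ≤ 5) (hmono : Monotone ℓ)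
    (hlt : ℓ 2 + 1 < 2 * k) (hsum : ∑ i, ℓ i < k ^ 2) : SpiderCoverable k ℓ := by
  have h₀₁ : ℓ 0 ≤ ℓ 1 := hmono (by decide)
  have h₁₂ : ℓ 1 ≤ ℓ 2 := hmono (by decide)
  rw [Fin.sum_univ_three] at hsum
  have of_table (b : Fin 3 → ℕ) (T : List (Fin 3 × ℕ)) (hT : ∀ i, ∀ d ≤ b i, ∃ ρ < k,
      spiderDist (T.getD ρ (0, 0)) (i, d) ≤ ρ) (hb : ∀ i, ℓ i ≤ b i) : SpiderCoverable k ℓ :=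
    SpiderCoverable.mono ⟨fun ρ => T.getD ρ (0, 0), hT⟩ hb
  have le_of (x y z : ℕ) (h₀ : ℓ 0 ≤ x) (h₁ : ℓ 1 ≤ y) (h₂ : ℓ 2 ≤ z) :
      ∀ i, ℓ i ≤ ![x, y, z] i := by
    intro i
    fin_cases i <;> assumption
  interval_cases k
  · omega
  · exact of_table ![0, 0, 0] [] (by decide) (le_of _ _ _ (by omega) (by omega) (by omega))
  · exact of_table ![1, 1, 2] [(2, 2), (2, 0)] (by decide)
      (le_of _ _ _ (by omega) (by omega) (by omega))
  · by_cases h : ℓ 1 = 4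
    · exact of_table ![0, 4, 4] [(2, 4), (1, 3), (2, 1)] (by decide)
        (le_of _ _ _ (by omega) (by omega) (by omega))
    · exact of_table ![2, 3, 4] [(1, 3), (2, 4), (2, 0)] (by decide)
        (le_of _ _ _ (by omega) (by omega) (by omega))
  · by_cases h : 5 ≤ ℓ 0
    · exact of_table ![5, 5, 5] [(2, 5), (1, 4), (0, 5), (2, 1)] (by decide)
        (le_of _ _ _ (by omega) (by omega) (by omega))
    · exact of_table ![4, 6, 6] [(0, 4), (1, 5), (2, 6), (2, 0)] (by decide)
        (le_of _ _ _ (by omega) (by omega) (by omega))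
  · exact of_table ![8, 8, 8] [(0, 8), (0, 6), (1, 7), (2, 8), (2, 0)] (by decide)
      (le_of _ _ _ (by omega) (by omega) (by omega))

/-- As long as the longest leg is long enough, the largest ball is used up on its end. -/
theorem spiderCoverable_of_sum_lt_sq (ℓ : Fin 3 → ℕ) (hsum : ∑ i, ℓ i < k ^ 2) :
    SpiderCoverable k ℓ := by
  induction k generalizing ℓ with
  | zero => simp at hsum
  | succ k ih =>
    wlog hmono : Monotone ℓ generalizing ℓ
    · exact SpiderCoverable.of_comp_equiv (Tuple.sort ℓ)
        (this (ℓ ∘ Tuple.sort ℓ) (by simpa only [Function.comp_apply, Equiv.sum_comp] using hsum)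
          (Tuple.monotone_sort ℓ))
    by_cases hlong : 2 * k + 1 ≤ ℓ 2
    · have hih := ih (Function.update ℓ 2 (ℓ 2 - (2 * k + 1))) (by
        simp only [Fin.sum_univ_three] at hsum ⊢
        simp only [Function.update_self, ne_eq, Fin.reduceEq, not_false_eq_true,
          Function.update_of_ne]
        nlinarith [Nat.sub_add_cancel hlong])
      simpa only [Function.update_self, Nat.sub_add_cancel hlong, Function.update_idem,
        Function.update_eq_self] using hih.extend_leg 2
    · rcases le_or_gt (k + 1) 5 with hk | hk
      · exact spiderCoverable_of_le_five hk hmono (by omega) hsum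
      · refine (spiderCoverable_of_six_le hk).mono fun i => ?_
        have hle : ℓ i ≤ ℓ 2 := hmono (Fin.le_last i)
        change ℓ i ≤ 2 * (k + 1) - 2
        omega

end Spider

section Legs

variable {V : Type*} {G : SimpleGraph V}

/-- The path that starts at `r` and continues with the vertices `x 0, …, x (m - 1)`, where it
stops: `leg r x d` is its vertex number `d`, and its last vertex if `d > m`. -/
def leg (r : V) {m : ℕ} (x : Fin m → V) : ℕ → V
  | 0 => r
  | d + 1 => if h : d < m then x ⟨d, h⟩ else leg r x d

theorem leg_succ (r : V) {m : ℕ} (x : Fin m → V) (d : Fin m) : leg r x (d + 1) = x d := by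
  simp [leg]

theorem edist_leg_le {r : V} {m : ℕ} {x : Fin m → V} (h : ∀ d : Fin m, G.Adj (leg r x d) (x d))
    (i j : ℕ) : G.edist (leg r x i) (leg r x j) ≤ Nat.dist i j := by
  have edist_add (i n : ℕ) : G.edist (leg r x i) (leg r x (i + n)) ≤ n := by
    induction n with
    | zero => simp
    | succ n ih =>
      by_cases hlt : i + n < m
      · have hadj := h ⟨i + n, hlt⟩
        rw [← leg_succ r x ⟨i + n, hlt⟩] at hadj
        exact edist_le_succ_of_adj ih hadj
      · rw [← Nat.add_assoc, leg, dif_neg hlt]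
        exact ih.trans (by exact_mod_cast n.le_succ)
  rcases le_total i j with hij | hij <;> obtain ⟨n, rfl⟩ := Nat.exists_eq_add_of_le hij
  · simpa [Nat.dist] using edist_add i n
  · simpa [Nat.dist, SimpleGraph.edist_comm] using edist_add j n

theorem isBurnable_of_legs {k : ℕ} {ℓ : Fin 3 → ℕ} (r : V) {F : Fin 3 → ℕ → V}
    (hF₀ : ∀ i, F i 0 = r) (hF : ∀ i d e, G.edist (F i d) (F i e) ≤ Nat.dist d e)
    (hcover : ∀ v, ∃ i, ∃ d ≤ ℓ i, F i d = v) (hsum : ∑ i, ℓ i < k ^ 2) : IsBurnable G k := by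
  have hdist (u v : Fin 3 × ℕ) : G.edist (F u.1 u.2) (F v.1 v.2) ≤ spiderDist u v := by
    obtain ⟨i, d⟩ := u
    obtain ⟨j, e⟩ := v
    by_cases hij : i = j
    · subst hij
      simpa only [spiderDist, if_true] using hF i d e
    · calc G.edist (F i d) (F j e) ≤ G.edist (F i d) (F i 0) + G.edist (F j 0) (F j e) := by
            rw [hF₀ i, ← hF₀ j]
            exact G.edist_triangle
        _ ≤ d + e := add_le_add (by simpa [Nat.dist] using hF i d 0)
            (by simpa [Nat.dist] using hF j 0 e)
        _ = spiderDist (i, d) (j, e) := by simp [spiderDist, hij]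
  have : Nonempty V := ⟨r⟩
  obtain ⟨c, hc⟩ := spiderCoverable_of_sum_lt_sq ℓ hsum
  refine isBurnable_iff_exists_cover.2 ⟨fun ρ => F (c ρ).1 (c ρ).2, fun v => ?_⟩
  obtain ⟨i, d, hd, rfl⟩ := hcover v
  obtain ⟨ρ, hρ, h⟩ := hc i d hd
  exact ⟨ρ, hρ, (hdist (c ρ) (i, d)).trans (by exact_mod_cast h)⟩

end Legs

section Unicyclic

variable {g a₁ a₂ : ℕ}

theorem cycleGraph_adj_val (hg : 3 ≤ g) (i j : Fin g) :
    (SimpleGraph.cycleGraph g).Adj i j ↔ (i : ℕ) + 1 = j ∨ (j : ℕ) + 1 = i ∨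
      ((i : ℕ) = 0 ∧ (j : ℕ) + 1 = g) ∨ ((j : ℕ) = 0 ∧ (i : ℕ) + 1 = g) := by
  have sub_eq_one_iff (a b : ℕ) (ha : a < g) (hb : b < g) :
      (g - b + a) % g = 1 ↔ b + 1 = a ∨ (a = 0 ∧ b + 1 = g) := by
    rcases lt_or_ge a b with h | h
    · rw [Nat.mod_eq_of_lt (by omega)]
      omega
    · rw [show g - b + a = (a - b) + g by omega, Nat.add_mod_right, Nat.mod_eq_of_lt (by omega)]
      omega
  simp only [SimpleGraph.cycleGraph_adj', Fin.sub_def, sub_eq_one_iff _ _ i.2 j.2,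
    sub_eq_one_iff _ _ j.2 i.2]
  omega

theorem adj_leg_of_adj_succ {V : Type*} {G : SimpleGraph V} {r : V} {m : ℕ} {x : Fin m → V}
    (h₀ : ∀ hm : 0 < m, G.Adj r (x ⟨0, hm⟩))
    (h : ∀ (d : ℕ) (hd : d + 1 < m), G.Adj (x ⟨d, by omega⟩) (x ⟨d + 1, hd⟩)) (d : Fin m) :
    G.Adj (leg r x d) (x d) := by
  obtain ⟨_ | d, hd⟩ := d
  · exact h₀ hd
  · exact leg_succ r x ⟨d, by omega⟩ ▸ h d hd

theorem isBurnable_twoArmUnicyclic {k : ℕ} (hg : 3 ≤ g) (hn : g + a₁ + a₂ ≤ k ^ 2) :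
    IsBurnable (twoArmUnicyclic g a₁ a₂) k := by
  let root : Fin g ⊕ Fin a₁ ⊕ Fin a₂ := .inl ⟨g - 1, by omega⟩
  let F : Fin 3 → ℕ → Fin g ⊕ Fin a₁ ⊕ Fin a₂ :=
    ![leg root fun d : Fin a₁ => .inr (.inl d), leg root fun d : Fin a₂ => .inr (.inr d),
      leg root fun d : Fin (g - 1) => .inl (d.castLE (by omega))]
  refine isBurnable_of_legs (ℓ := ![a₁, a₂, g - 1]) (F := F) root ?_ ?_ ?_ ?_
  · intro i
    fin_cases i <;> rfl
  · intro i
    fin_cases i <;> refine edist_leg_le (adj_leg_of_adj_succ (fun hm => ?_) fun d hd => ?_) <;>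
      simp only [root, twoArmUnicyclic, SimpleGraph.fromRel_adj, SimpleGraph.pathGraph_adj,
        cycleGraph_adj_val hg, ne_eq, reduceCtorEq, Sum.inl.injEq, Sum.inr.injEq, Fin.mk.injEq,
        Fin.castLE_mk, not_false_eq_true, true_and, and_true, true_or, or_true,
        or_false] <;> omega
  · rintro (i | i | i)
    · by_cases h : (i : ℕ) < g - 1
      · exact ⟨2, i + 1, h, leg_succ root _ ⟨i, h⟩⟩
      · exact ⟨2, 0, Nat.zero_le _, congrArg Sum.inl (Fin.ext (by simp only; omega))⟩
    · exact ⟨0, i + 1, i.2, leg_succ root _ i⟩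
    · exact ⟨1, i + 1, i.2, leg_succ root _ i⟩
  · rw [Fin.sum_univ_three]
    change a₁ + a₂ + (g - 1) < k ^ 2
    omega

/-- The distance of a vertex from the branching vertex `v_g`. -/
def depth : Fin g ⊕ Fin a₁ ⊕ Fin a₂ → ℕ
  | .inl i => min (i + 1) (g - (i + 1))
  | .inr (.inl i) => i + 1
  | .inr (.inr i) => i + 1

/-- The distance in `twoArmUnicyclic g a₁ a₂`, in coordinates. -/
def armDist : Fin g ⊕ Fin a₁ ⊕ Fin a₂ → Fin g ⊕ Fin a₁ ⊕ Fin a₂ → ℕ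
  | .inl i, .inl j => min (Nat.dist i j) (g - Nat.dist i j)
  | .inr (.inl i), .inr (.inl j) => Nat.dist i j
  | .inr (.inr i), .inr (.inr j) => Nat.dist i j
  | x, y => depth x + depth y

/-- The part of the graph that contains a vertex: `0` and `1` stand for the arms of lengths `a₁` and
`a₂`, and `2` stands for the cycle. -/
def branch : Fin g ⊕ Fin a₁ ⊕ Fin a₂ → Fin 3
  | .inl _ => 2
  | .inr (.inl _) => 0
  | .inr (.inr _) => 1

/-- The number of a vertex on its branch, starting from `1`; on the cycle `v_i` has number `i`. -/
def pos : Fin g ⊕ Fin a₁ ⊕ Fin a₂ → ℕ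
  | .inl i => i + 1
  | .inr (.inl i) => i + 1
  | .inr (.inr i) => i + 1

/-- The vertices of the branch `b` that are farther than `s` from the branching vertex. -/
def segment (g a₁ a₂ : ℕ) (b : Fin 3) (s : ℕ) : Finset (Fin g ⊕ Fin a₁ ⊕ Fin a₂) :=
  {v | branch v = b ∧ s < depth v}

theorem armDist_le_of_edist_le (hg : 3 ≤ g) {u v : Fin g ⊕ Fin a₁ ⊕ Fin a₂} {n : ℕ}
    (h : (twoArmUnicyclic g a₁ a₂).edist u v ≤ n) : armDist u v ≤ n := by
  have armDist_adj (c u v : Fin g ⊕ Fin a₁ ⊕ Fin a₂) (h : (twoArmUnicyclic g a₁ a₂).Adj u v) :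
      armDist c v ≤ armDist c u + 1 := by
    rw [twoArmUnicyclic, SimpleGraph.fromRel_adj] at h
    obtain ⟨-, h⟩ := h
    rcases u with u | u | u <;> rcases v with v | v | v <;>
      simp only [cycleGraph_adj_val hg, SimpleGraph.pathGraph_adj, or_false, false_or,
        or_self] at h <;>
      rcases c with c | c | c <;> simp only [armDist, depth, Nat.dist] <;> omega
  have armDist_self : armDist u u = 0 := by
    rcases u with i | i | i <;> simp [armDist]
  simpa only [armDist_self, Nat.zero_add] using le_add_of_edist_le (armDist_adj u) h

theorem pos_injOn (b : Fin 3) : Set.InjOn pos {v : Fin g ⊕ Fin a₁ ⊕ Fin a₂ | branch v = b} := by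
  rintro u rfl v hv h
  rcases u with u | u | u <;> rcases v with v | v | v <;>
    simp only [branch, Set.mem_ofPred_eq, Fin.reduceEq, pos, Nat.add_right_cancel_iff] at hv h <;>
    rw [Fin.ext h]

theorem le_card_segment (b : Fin 3) (s : ℕ) :
    ![a₁ - s, a₂ - s, g - (2 * s + 1)] b ≤ (segment g a₁ a₂ b s).card := by
  have le_card (b : Fin 3) (hi : ℕ) (h : ∀ x ∈ Finset.Ioo s hi,
      ∃ v : Fin g ⊕ Fin a₁ ⊕ Fin a₂, (branch v = b ∧ s < depth v) ∧ pos v = x) :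
      hi - s - 1 ≤ (segment g a₁ a₂ b s).card :=
    (Nat.card_Ioo s hi).symm.trans_le (Finset.card_le_card_of_surjOn pos fun x hx => by
      simpa [segment] using h x (by simpa using hx))
  match b with
  | 0 =>
    refine le_trans (b := a₁ + 1 - s - 1) ?_ (le_card 0 (a₁ + 1) fun x hx => ?_)
    · change a₁ - s ≤ _
      omega
    · rw [Finset.mem_Ioo] at hx
      refine ⟨.inr (.inl ⟨x - 1, by omega⟩), ⟨rfl, ?_⟩, ?_⟩ <;> simp only [depth, pos] <;> omega
  | 1 =>
    refine le_trans (b := a₂ + 1 - s - 1) ?_ (le_card 1 (a₂ + 1) fun x hx => ?_)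
    · change a₂ - s ≤ _
      omega
    · rw [Finset.mem_Ioo] at hx
      refine ⟨.inr (.inr ⟨x - 1, by omega⟩), ⟨rfl, ?_⟩, ?_⟩ <;> simp only [depth, pos] <;> omega
  | 2 =>
    refine le_trans (b := g - s - s - 1) ?_ (le_card 2 (g - s) fun x hx => ?_)
    · change g - (2 * s + 1) ≤ _
      omega
    · rw [Finset.mem_Ioo] at hx
      refine ⟨.inl ⟨x - 1, by omega⟩, ⟨rfl, ?_⟩, ?_⟩ <;> simp only [depth, pos] <;> omega

section DeepBall

variable {c v : Fin g ⊕ Fin a₁ ⊕ Fin a₂} {ρ s : ℕ}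

/-- The part of the ball of radius `ρ` around `c` that lies in the branch of `c` and is farther than
`s` from the branching vertex. -/
def deepBall (c : Fin g ⊕ Fin a₁ ⊕ Fin a₂) (ρ s : ℕ) : Finset (Fin g ⊕ Fin a₁ ⊕ Fin a₂) :=
  {v ∈ segment g a₁ a₂ (branch c) s | armDist c v ≤ ρ}

theorem branch_eq_of_armDist_le (hρ : ρ ≤ s + depth c) (hv : s < depth v) (h : armDist c v ≤ ρ) :
    branch v = branch c := by
  rcases c with c | c | c <;> rcases v with v | v | v <;> first
    | rfl
    | simp only [armDist] at h
      omega

/-- The bound on `ρ` keeps the deep ball from reaching around the cycle. -/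
theorem pos_bounds_of_mem_deepBall (hρ : ρ ≤ s + depth c) (hv : v ∈ deepBall c ρ s) :
    pos c ≤ pos v + ρ ∧ pos v ≤ pos c + ρ := by
  simp only [deepBall, segment, Finset.mem_filter, Finset.mem_univ, true_and] at hv
  obtain ⟨⟨hb, hs⟩, h⟩ := hv
  rcases c with c | c | c <;> rcases v with v | v | v <;>
    simp only [branch, Fin.reduceEq, armDist, depth, Nat.dist, pos] at * <;> omega

theorem card_deepBall_le_of_pos_mem {S : Finset ℕ} (h : ∀ v ∈ deepBall c ρ s, pos v ∈ S) :
    (deepBall c ρ s).card ≤ S.card :=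
  Finset.card_le_card_of_injOn pos h ((pos_injOn (branch c)).mono fun v hv => by
    simp only [deepBall, segment, Finset.coe_filter, Finset.mem_filter] at hv
    exact hv.1.2.1)

theorem card_deepBall_le (hρ : ρ ≤ s + depth c) : (deepBall c ρ s).card ≤ 2 * ρ + 1 :=
  calc (deepBall c ρ s).card ≤ (Finset.Icc (pos c - ρ) (pos c + ρ)).card :=
        card_deepBall_le_of_pos_mem fun v hv => by
          have := pos_bounds_of_mem_deepBall hρ hv
          rw [Finset.mem_Icc]
          omega
    _ ≤ 2 * ρ + 1 := by
      rw [Nat.card_Icc]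
      omega

theorem card_deepBall_le_two_mul_depth (hρ : ρ = s + depth c) :
    (deepBall c ρ s).card ≤ 2 * depth c := by
  have pos_mem {v} (hv : v ∈ deepBall c ρ s) :
      (pos c ≤ pos v + ρ ∧ pos v ≤ pos c + ρ) ∧ branch v = branch c ∧ s < depth v := by
    refine ⟨pos_bounds_of_mem_deepBall hρ.le hv, ?_⟩
    simpa only [segment, Finset.mem_filter, Finset.mem_univ, true_and] using
      (Finset.mem_filter.1 hv).1
  by_cases hc : pos c = depth c
  · refine (card_deepBall_le_of_pos_mem (S := Finset.Ioc s (pos c + ρ)) fun v hv => ?_).trans ?_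
    · have depth_le_pos : depth v ≤ pos v := by rcases v with v | v | v <;> simp [depth, pos]
      have := pos_mem hv
      rw [Finset.mem_Ioc]
      omega
    · rw [Nat.card_Ioc]
      omega
  · obtain ⟨i, rfl⟩ : ∃ i, c = .inl i := by
      rcases c with i | i | i
      exacts [⟨i, rfl⟩, absurd rfl hc, absurd rfl hc]
    simp only [pos, depth] at hc hρ ⊢
    refine (card_deepBall_le_of_pos_mem (S := Finset.Ico (i + 1 - ρ) (g - s)) fun v hv => ?_).trans
      ?_
    · have := pos_mem hv
      rcases v with j | j | j <;> simp only [pos, depth, branch, Fin.reduceEq, false_and,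
        and_false] at this
      rw [Finset.mem_Ico, pos]
      omega
    · rw [Nat.card_Ico]
      omega

end DeepBall

end Unicyclic

section OddSum

open Finset

variable {X Y : Finset ℕ} {m x y b : ℕ}

/-- The number of vertices in balls of radii `ρ ∈ X` in a long path, if these are disjoint. -/
def oddSum (X : Finset ℕ) : ℕ := ∑ ρ ∈ X, (2 * ρ + 1)

theorem oddSum_erase (h : m ∈ X) : oddSum (X.erase m) + (2 * m + 1) = oddSum X :=
  sum_erase_add X _ h

theorem oddSum_union (h : Disjoint X Y) : oddSum (X ∪ Y) = oddSum X + oddSum Y :=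
  sum_union h

theorem oddSum_range (q : ℕ) : oddSum (range q) = q ^ 2 := by
  induction q with
  | zero => rfl
  | succ q ih =>
    rw [oddSum] at ih ⊢
    rw [sum_range_succ, ih]
    ring

theorem subset_range_of_oddSum_le (h : oddSum X ≤ 2 * m) : X ⊆ range m := by
  intro i hi
  have := oddSum_erase hi
  exact mem_range.2 (by omega)

theorem subset_range_of_notMem (hX : X ⊆ range (m + 1)) (hm : m ∉ X) : X ⊆ range m := by
  rwa [range_add_one, subset_insert_iff_of_notMem hm] at hX

theorem erase_subset_range (hX : X ⊆ range (m + 1)) : X.erase m ⊆ range m :=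
  subset_range_of_notMem ((erase_subset _ _).trans hX) (notMem_erase _ _)

/-- Paths with `x` and `y` vertices can be covered by balls that have distinct radii less than `m`
and at most `b` vertices in total. -/
def CanCover (m x y b : ℕ) : Prop :=
  ∃ X ⊆ range m, ∃ Y ⊆ range m,
    Disjoint X Y ∧ x ≤ oddSum X ∧ y ≤ oddSum Y ∧ oddSum X + oddSum Y ≤ b

theorem canCover_zero_iff : CanCover 0 x y b ↔ x = 0 ∧ y = 0 := by
  simp [CanCover, oddSum]

theorem CanCover.symm (h : CanCover m x y b) : CanCover m y x b :=
  let ⟨X, hX, Y, hY, hXY, hx, hy, hb⟩ := h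
  ⟨Y, hY, X, hX, hXY.symm, hy, hx, by rwa [Nat.add_comm]⟩

theorem CanCover.succ (h : CanCover m x y b) : CanCover (m + 1) x y b :=
  let ⟨X, hX, Y, hY, h⟩ := h
  have hm := range_subset_range.2 m.le_succ
  ⟨X, hX.trans hm, Y, hY.trans hm, h⟩

theorem CanCover.insert_left (hb : 2 * m + 1 ≤ b)
    (h : CanCover m (x - (2 * m + 1)) y (b - (2 * m + 1))) : CanCover (m + 1) x y b := by
  obtain ⟨X, hX, Y, hY, hXY, hx, hy, hb'⟩ := h
  have hmX : m ∉ X := fun h => (mem_range.1 (hX h)).false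
  have hmY : m ∉ Y := fun h => (mem_range.1 (hY h)).false
  have hsum : oddSum (insert m X) = 2 * m + 1 + oddSum X := sum_insert hmX
  refine ⟨insert m X, ?_, Y, hY.trans (range_subset_range.2 m.le_succ),
    disjoint_insert_left.2 ⟨hmY, hXY⟩, by omega, hy, by omega⟩
  rw [range_add_one]
  exact insert_subset_insert m hX

theorem canCover_succ_iff : CanCover (m + 1) x y b ↔ CanCover m x y b ∨
    2 * m + 1 ≤ b ∧ (CanCover m (x - (2 * m + 1)) y (b - (2 * m + 1)) ∨
      CanCover m x (y - (2 * m + 1)) (b - (2 * m + 1))) := by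
  constructor
  · rintro ⟨X, hX, Y, hY, hXY, hx, hy, hb⟩
    by_cases hmX : m ∈ X
    · have := oddSum_erase hmX
      exact Or.inr ⟨by omega, Or.inl ⟨X.erase m, erase_subset_range hX, Y,
        subset_range_of_notMem hY (disjoint_left.1 hXY hmX),
        hXY.mono_left (erase_subset _ _), by omega, hy, by omega⟩⟩
    by_cases hmY : m ∈ Y
    · have := oddSum_erase hmY
      exact Or.inr ⟨by omega, Or.inr ⟨X, subset_range_of_notMem hX hmX, Y.erase m,
        erase_subset_range hY, hXY.mono_right (erase_subset _ _), hx, by omega, by omega⟩⟩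
    · exact Or.inl ⟨X, subset_range_of_notMem hX hmX, Y, subset_range_of_notMem hY hmY,
        hXY, hx, hy, hb⟩
  · rintro (h | ⟨hb, h | h⟩)
    · exact h.succ
    · exact h.insert_left hb
    · exact (h.symm.insert_left hb).symm

instance decidableCanCover (m x y b : ℕ) : Decidable (CanCover m x y b) :=
  match m with
  | 0 => decidable_of_iff' _ canCover_zero_iff
  | m + 1 =>
    have := decidableCanCover m
    decidable_of_iff' _ canCover_succ_iff

/-- A ball of radius at least `m` alone would exceed the bound `2 * m`. -/
theorem lt_oddSum_add (hXY : Disjoint X Y) (hx : x ≤ oddSum X) (hy : y ≤ oddSum Y)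
    (hb : b ≤ 2 * m) (h : ¬ CanCover m x y b) : b < oddSum X + oddSum Y := by
  contrapose! h
  exact ⟨X, subset_range_of_oddSum_le (by omega), Y, subset_range_of_oddSum_le (by omega), hXY,
    hx, hy, h⟩

theorem oddSum_ne_two : oddSum X ≠ 2 := by
  intro h
  have hle : oddSum X ≤ oddSum (range 1) :=
    sum_le_sum_of_subset (subset_range_of_oddSum_le (by omega))
  rw [oddSum_range] at hle
  omega

end OddSum

section Profile

open Finset

variable {q g a₁ a₂ : ℕ}

/-- The sizes in a cover of `twoArmUnicyclic g a₁ a₂` by balls of radii `0, …, q - 1`. The ball of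
radius `p` contains the ball of radius `s` around the branching vertex, and no larger ball around
that vertex is contained in one of the other balls. Outside of it, the ball of radius `p` covers
`e₁`, `e₂`, `e₃` vertices of the two arms and of the cycle, and the balls of radii in `X`, `Y`, `Z`
cover the rest. -/
structure Profile (q g a₁ a₂ : ℕ) where
  (s p : ℕ)
  (X Y Z : Finset ℕ)
  (e₁ e₂ e₃ : ℕ)
  s_le_p : s ≤ p
  p_lt : p < q
  disjoint_XY : Disjoint X Y
  disjoint_XZ : Disjoint X Z
  disjoint_YZ : Disjoint Y Z
  union_eq : X ∪ Y ∪ Z = (range q).erase p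
  extra_eq : e₁ + e₂ + e₃ = 2 * (p - s)
  arm₁_le : a₁ ≤ oddSum X + e₁ + s
  arm₂_le : a₂ ≤ oddSum Y + e₂ + s
  cycle_le : g ≤ oddSum Z + e₃ + (2 * s + 1)

theorem exists_dominant_ball (hg : 3 ≤ g) {c : ℕ → Fin g ⊕ Fin a₁ ⊕ Fin a₂}
    (hc : ∀ v, ∃ ρ < q, armDist (c ρ) v ≤ ρ) :
    ∃ p < q, ∃ s, p = s + depth (c p) ∧ ∀ ρ < q, ρ ≤ s + depth (c ρ) := by
  let root : Fin g ⊕ Fin a₁ ⊕ Fin a₂ := .inl ⟨g - 1, by omega⟩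
  have depth_le (v : Fin g ⊕ Fin a₁ ⊕ Fin a₂) : depth v ≤ armDist v root := by
    rcases v with v | v | v <;> simp only [root, armDist, depth, Nat.dist] <;> omega
  obtain ⟨ρ₀, hρ₀, hroot⟩ := hc root
  obtain ⟨p, hp, hmax⟩ := exists_max_image (range q) (fun ρ => (ρ : ℤ) - depth (c ρ))
    ⟨ρ₀, mem_range.2 hρ₀⟩
  simp only [mem_range] at hp hmax
  have := depth_le (c ρ₀)
  have := hmax ρ₀ hρ₀
  refine ⟨p, hp, p - depth (c p), by omega, fun ρ hρ => ?_⟩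
  have := hmax ρ hρ
  omega

theorem card_segment_le {c : ℕ → Fin g ⊕ Fin a₁ ⊕ Fin a₂} {s p : ℕ}
    (hc : ∀ v, ∃ ρ < q, armDist (c ρ) v ≤ ρ) (hpq : p < q) (hp : p = s + depth (c p))
    (hs : ∀ ρ < q, ρ ≤ s + depth (c ρ)) (b : Fin 3) :
    #(segment g a₁ a₂ b s) ≤ oddSum {ρ ∈ (range q).erase p | branch (c ρ) = b} +
      if branch (c p) = b then 2 * (p - s) else 0 := by
  have subset : segment g a₁ a₂ b s ⊆
      {ρ ∈ range q | branch (c ρ) = b}.biUnion fun ρ => deepBall (c ρ) ρ s := by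
    intro v hv
    obtain ⟨ρ, hρ, h⟩ := hc v
    have hvb : branch v = b ∧ s < depth v := by simpa [segment] using hv
    have hb : branch (c ρ) = b := (branch_eq_of_armDist_le (hs ρ hρ) hvb.2 h).symm.trans hvb.1
    exact mem_biUnion.2 ⟨ρ, by simp [hρ, hb], by simp [deepBall, hb, hv, h]⟩
  calc #(segment g a₁ a₂ b s)
      ≤ ∑ ρ ∈ range q with branch (c ρ) = b, #(deepBall (c ρ) ρ s) :=
        (card_le_card subset).trans card_biUnion_le
    _ = ∑ ρ ∈ (range q).erase p with branch (c ρ) = b, #(deepBall (c ρ) ρ s) +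
          if branch (c p) = b then #(deepBall (c p) p s) else 0 := by
      simp only [sum_filter]
      exact (sum_erase_add _ _ (mem_range.2 hpq)).symm
    _ ≤ _ := by
      refine add_le_add (sum_le_sum fun ρ hρ => ?_) ?_
      · exact card_deepBall_le (hs ρ (mem_range.1 (mem_of_mem_erase (mem_filter.1 hρ).1)))
      · have := card_deepBall_le_two_mul_depth hp
        split_ifs <;> omega

theorem nonempty_profile (hg : 3 ≤ g) (h : IsBurnable (twoArmUnicyclic g a₁ a₂) q) :
    Nonempty (Profile q g a₁ a₂) := by
  have : Nonempty (Fin g ⊕ Fin a₁ ⊕ Fin a₂) := ⟨.inl ⟨0, by omega⟩⟩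
  obtain ⟨c, hc⟩ := isBurnable_iff_exists_cover.1 h
  replace hc (v) : ∃ ρ < q, armDist (c ρ) v ≤ ρ :=
    let ⟨ρ, hρ, h⟩ := hc v
    ⟨ρ, hρ, armDist_le_of_edist_le hg h⟩
  obtain ⟨p, hpq, s, hp, hs⟩ := exists_dominant_ball hg hc
  have disjoint {b b' : Fin 3} (hb : b ≠ b') :
      Disjoint ({ρ ∈ (range q).erase p | branch (c ρ) = b})
        {ρ ∈ (range q).erase p | branch (c ρ) = b'} :=
    disjoint_filter.2 fun ρ _ h h' => hb (h.symm.trans h')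
  have le_oddSum (b : Fin 3) := (le_card_segment b s).trans (card_segment_le hc hpq hp hs b)
  refine ⟨{
    s, p
    X := {ρ ∈ (range q).erase p | branch (c ρ) = 0}
    Y := {ρ ∈ (range q).erase p | branch (c ρ) = 1}
    Z := {ρ ∈ (range q).erase p | branch (c ρ) = 2}
    e₁ := if branch (c p) = 0 then 2 * (p - s) else 0
    e₂ := if branch (c p) = 1 then 2 * (p - s) else 0
    e₃ := if branch (c p) = 2 then 2 * (p - s) else 0
    s_le_p := by omega
    p_lt := hpq
    disjoint_XY := disjoint (by decide)
    disjoint_XZ := disjoint (by decide)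
    disjoint_YZ := disjoint (by decide)
    union_eq := ?_
    extra_eq := ?_
    arm₁_le := Nat.sub_le_iff_le_add.1 (le_oddSum 0)
    arm₂_le := Nat.sub_le_iff_le_add.1 (le_oddSum 1)
    cycle_le := Nat.sub_le_iff_le_add.1 (le_oddSum 2) }⟩
  · simp only [← filter_or, filter_eq_self]
    intro ρ _
    generalize branch (c ρ) = b
    fin_cases b <;> simp
  · generalize branch (c p) = b
    fin_cases b <;> simp

namespace Profile

theorem sum_eq (P : Profile q g a₁ a₂) :
    oddSum P.X + oddSum P.Y + oddSum P.Z + (2 * P.p + 1) = q ^ 2 := by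
  rw [← oddSum_union P.disjoint_XY,
    ← oddSum_union (disjoint_union_left.2 ⟨P.disjoint_XZ, P.disjoint_YZ⟩),
    P.union_eq, oddSum_erase (mem_range.2 P.p_lt), oddSum_range]

theorem bounds (P : Profile q g a₁ a₂) :
    P.s ≤ P.p ∧ P.p < q ∧ P.e₁ + P.e₂ + P.e₃ = 2 * (P.p - P.s) ∧
      oddSum P.X + oddSum P.Y + oddSum P.Z + (2 * P.p + 1) = q ^ 2 ∧
      a₁ ≤ oddSum P.X + P.e₁ + P.s ∧ a₂ ≤ oddSum P.Y + P.e₂ + P.s ∧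
      g ≤ oddSum P.Z + P.e₃ + (2 * P.s + 1) :=
  ⟨P.s_le_p, P.p_lt, P.extra_eq, P.sum_eq, P.arm₁_le, P.arm₂_le, P.cycle_le⟩

theorem order_add_two_le (P : Profile q g a₁ a₂) : g + a₁ + a₂ + 2 ≤ q ^ 2 + 2 * q := by
  have := P.bounds
  omega

theorem arms_lt (P : Profile q g a₁ a₂) : a₁ + a₂ < q ^ 2 := by
  have := P.bounds
  omega

theorem cycle_le_sq (P : Profile q g a₁ a₂) : g ≤ q ^ 2 := by
  have := P.bounds
  omega

theorem arm_add_half_cycle_lt (P : Profile q g a₁ a₂) : a₁ + g / 2 < q ^ 2 := by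
  have := P.bounds
  omega

theorem arm_add_cycle_lt (P : Profile q g a₁ a₂) : a₁ + g < q ^ 2 + q := by
  have := P.bounds
  omega

theorem subset_range (P : Profile q g a₁ a₂) (h : P.p + 1 = q) :
    P.X ⊆ range P.p ∧ P.Y ⊆ range P.p ∧ P.Z ⊆ range P.p := by
  have hunion : P.X ∪ P.Y ∪ P.Z ⊆ range P.p := by
    rw [P.union_eq]
    intro ρ
    simp only [mem_erase, mem_range]
    omega
  simpa only [union_subset_iff, and_assoc] using hunion

end Profile

end Profile

section Exceptional

open Finset

variable {q r g a₁ a₂ d m u v w x y : ℕ} {X Y : Finset ℕ}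

/-- The pairs `(x, y)` from which `armTriple` and `cycleTriple` produce exceptional triples of order
`q ^ 2 + 2 * q - 2 - d`. -/
def unsplittablePairs : ℕ → Finset (ℕ × ℕ)
  | 0 => {(1, 1), (3, 3), (5, 5), (2, 1), (4, 1), (4, 3), (4, 4), (6, 1), (6, 4), (6, 5), (6, 6),
      (7, 7), (8, 4), (8, 6), (10, 4)}
  | 1 => {(1, 1), (2, 2), (2, 3), (2, 4), (3, 2), (3, 3), (4, 2), (5, 5)}
  | 2 => {(2, 2), (2, 3), (3, 2)}
  | _ => ∅

/-- The triple of order `q ^ 2 + 2 * q - 2 - d` in which the ball of radius `q - 1` around the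
branching vertex leaves `x` and `y` vertices of the two arms. -/
def armTriple (q : ℤ) (d : ℕ) : ℕ × ℕ → ℤ × ℤ × ℤ
  | (x, y) => (q ^ 2 - d - x - y, q - 1 + x, q - 1 + y)

/-- The triple of order `q ^ 2 + 2 * q - 2 - d` in which the ball of radius `q - 1` around the
branching vertex leaves `z` vertices of the cycle and `y` vertices of the second arm. -/
def cycleTriple (q : ℤ) (d : ℕ) : ℕ × ℕ → ℤ × ℤ × ℤ
  | (z, y) => (2 * q - 1 + z, q ^ 2 - q - d - z - y, q - 1 + y)

/-- The quadruples `(m, u, v, w)` with `u + v + w + d = m ^ 2` from which `sporadicTriples` produces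
exceptional triples. -/
def sporadicPartitions : ℕ → Finset (ℕ × ℕ × ℕ × ℕ)
  | 0 => {(5, 13, 11, 1), (5, 11, 11, 3), (6, 22, 13, 1), (6, 19, 13, 4), (6, 17, 13, 6),
      (6, 15, 13, 8), (6, 13, 13, 10), (6, 17, 15, 4), (6, 15, 15, 6), (7, 30, 15, 4),
      (7, 28, 15, 6), (7, 26, 15, 8), (7, 19, 15, 15), (7, 28, 17, 4), (7, 26, 17, 6),
      (7, 17, 17, 15), (7, 26, 19, 4), (8, 43, 17, 4), (8, 41, 17, 6), (8, 30, 17, 17),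
      (8, 41, 19, 4), (8, 30, 30, 4), (9, 58, 19, 4)}
  | 1 => {(5, 11, 11, 2)}
  | _ => ∅

/-- The triples for which the ball of radius `m` around the branching vertex leaves `u`, `v` and `w`
vertices of the cycle and the two arms, in some order. -/
def sporadicTriples (d : ℕ) : Set (ℤ × ℤ × ℤ) :=
  let place (f : ℕ × ℕ × ℕ × ℕ → ℤ × ℤ × ℤ) := f '' sporadicPartitions d
  place (fun (m, u, v, w) => (2 * m + 1 + u, m + v, m + w)) ∪
    place (fun (m, u, v, w) => (2 * m + 1 + v, m + u, m + w)) ∪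
    place (fun (m, u, v, w) => (2 * m + 1 + w, m + u, m + v))

theorem setB₁_subset (q : ℤ) : setB₁ q ⊆ armTriple q 0 '' unsplittablePairs 0 := by
  simp only [unsplittablePairs, coe_insert, coe_singleton, Set.image_insert_eq,
    Set.image_singleton, armTriple, setB₁]
  push_cast
  ring_nf
  rfl

theorem setB₂_subset (q : ℤ) : setB₂ q ⊆ cycleTriple q 0 '' unsplittablePairs 0 := by
  simp only [unsplittablePairs, coe_insert, coe_singleton, Set.image_insert_eq,
    Set.image_singleton, cycleTriple, setB₂]
  push_cast
  ring_nf
  rfl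

theorem setB₃_subset (q : ℤ) :
    setB₃ q ⊆ (fun t : ℕ × ℕ => cycleTriple q 0 t.swap) '' unsplittablePairs 0 := by
  simp only [unsplittablePairs, coe_insert, coe_singleton, Set.image_insert_eq,
    Set.image_singleton, Prod.swap, cycleTriple, setB₃]
  push_cast
  ring_nf
  simp [Set.insert_subset_iff]

theorem setC₂_subset (q : ℤ) : setC₂ q ⊆
    armTriple q 2 '' unsplittablePairs 2 ∪ cycleTriple q 2 '' unsplittablePairs 2 := by
  simp only [unsplittablePairs, coe_insert, coe_singleton, Set.image_insert_eq,
    Set.image_singleton, armTriple, cycleTriple, setC₂]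
  push_cast
  ring_nf
  simp [Set.insert_subset_iff]

theorem setC₃_subset (q : ℤ) : setC₃ q ⊆ armTriple q 1 '' unsplittablePairs 1 ∪
    cycleTriple q 1 '' unsplittablePairs 1 ∪ sporadicTriples 1 := by
  have h₁ : (22, 16, 7) ∈ sporadicTriples 1 := by
    simp [sporadicTriples, sporadicPartitions]
  have h₂ : (13, 16, 16) ∈ sporadicTriples 1 := by
    simp [sporadicTriples, sporadicPartitions]
  simp only [unsplittablePairs, coe_insert, coe_singleton, Set.image_insert_eq,
    Set.image_singleton, armTriple, cycleTriple, setC₃]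
  push_cast
  ring_nf
  simp [Set.insert_subset_iff, h₁, h₂]

theorem setB₄_union_subset : setB₄ ∪ setB₅ ∪ setB₆ ⊆ sporadicTriples 0 := by
  simp only [sporadicTriples, sporadicPartitions, coe_insert, coe_singleton, Set.image_insert_eq,
    Set.image_singleton]
  norm_num only
  rfl

theorem lt_oddSum_add_of_mem_unsplittablePairs (hXY : Disjoint X Y)
    (h : (x, y) ∈ unsplittablePairs d) (hx : x ≤ oddSum X) (hy : y ≤ oddSum Y) :
    x + y + d < oddSum X + oddSum Y := by
  have not_canCover : ∀ d ≤ 2, ∀ t ∈ unsplittablePairs d,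
      t.1 + t.2 + d ≤ 2 * 7 ∧ ¬ CanCover 7 t.1 t.2 (t.1 + t.2 + d) := by
    decide +kernel
  obtain _ | _ | _ | d := d
  on_goal 4 => simp [unsplittablePairs] at h
  all_goals
    obtain ⟨hle, hcover⟩ := not_canCover _ (by decide) _ h
    exact lt_oddSum_add hXY hx hy hle hcover

theorem lt_oddSum_add_of_mem_sporadicPartitions (hXY : Disjoint X Y) (hX : X ⊆ range m)
    (hY : Y ⊆ range m) (h : (m, u, v, w) ∈ sporadicPartitions d) (hv : v ≤ oddSum X)
    (hw : w ≤ oddSum Y) : v + w + d < oddSum X + oddSum Y := by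
  have not_canCover : ∀ d ≤ 1, ∀ t ∈ sporadicPartitions d,
      ¬ CanCover t.1 t.2.2.1 t.2.2.2 (t.2.2.1 + t.2.2.2 + d) := by
    decide +kernel
  by_contra! hle
  obtain _ | _ | d := d
  on_goal 3 => simp [sporadicPartitions] at h
  all_goals exact not_canCover _ (by decide) _ h ⟨X, hX, Y, hY, hXY, hv, hw, hle⟩

theorem sum_of_mem_sporadicPartitions (h : (m, u, v, w) ∈ sporadicPartitions d) :
    u + v + w + d = m ^ 2 ∧ d ≤ 1 := by
  have sum_eq : ∀ d ≤ 1, ∀ t ∈ sporadicPartitions d,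
      t.2.1 + t.2.2.1 + t.2.2.2 + d = t.1 ^ 2 := by
    decide
  obtain _ | _ | d := d
  on_goal 3 => simp [sporadicPartitions] at h
  all_goals exact ⟨sum_eq _ (by decide) _ h, by decide⟩

namespace Profile

theorem notMem_armTriple (P : Profile q g a₁ a₂) (hs : d ≤ 1 ∨ P.s + 1 = q) :
    ((g : ℤ), (a₁ : ℤ), (a₂ : ℤ)) ∉ armTriple q d '' unsplittablePairs d := by
  rintro ⟨⟨x, y⟩, hxy, h⟩
  simp only [armTriple, Prod.mk.injEq] at h
  have hsq := Nat.cast_pow (α := ℤ) q 2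
  have := P.bounds
  have := lt_oddSum_add_of_mem_unsplittablePairs P.disjoint_XY hxy (by omega) (by omega)
  omega

theorem notMem_cycleTriple (P : Profile q g a₁ a₂) (hs : d ≤ 1 ∨ P.s + 1 = q) :
    ((g : ℤ), (a₁ : ℤ), (a₂ : ℤ)) ∉ cycleTriple q d '' unsplittablePairs d := by
  rintro ⟨⟨z, y⟩, hzy, h⟩
  simp only [cycleTriple, Prod.mk.injEq] at h
  have hsq := Nat.cast_pow (α := ℤ) q 2
  have := P.bounds
  have := lt_oddSum_add_of_mem_unsplittablePairs P.disjoint_YZ.symm hzy (by omega) (by omega)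
  omega

theorem notMem_cycleTriple_swap (P : Profile q g a₁ a₂) (hs : d ≤ 1 ∨ P.s + 1 = q) :
    ((g : ℤ), (a₁ : ℤ), (a₂ : ℤ)) ∉
      (fun t : ℕ × ℕ => cycleTriple q d t.swap) '' unsplittablePairs d := by
  rintro ⟨⟨y, z⟩, hyz, h⟩
  simp only [cycleTriple, Prod.swap, Prod.mk.injEq] at h
  have hsq := Nat.cast_pow (α := ℤ) q 2
  have := P.bounds
  have := lt_oddSum_add_of_mem_unsplittablePairs P.disjoint_YZ hyz (by omega) (by omega)
  omega

theorem eq_of_mem_sporadicPartitions (P : Profile q g a₁ a₂) (hn : q ^ 2 < g + a₁ + a₂)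
    (ht : (m, u, v, w) ∈ sporadicPartitions d) (h : g + a₁ + a₂ = u + v + w + (4 * m + 1)) :
    q = m + 1 ∧ P.s = m ∧ P.p = m := by
  obtain ⟨hsum, hd⟩ := sum_of_mem_sporadicPartitions ht
  have := P.bounds
  have hle : q < m + 2 := lt_of_pow_lt_pow_left₀ 2 (by omega) (by lia)
  have hge : m + 2 < q + 2 := lt_of_pow_lt_pow_left₀ 2 (by omega) (by lia)
  obtain rfl : q = m + 1 := by omega
  have hsq : (m + 1) ^ 2 = m ^ 2 + 2 * m + 1 := by ring
  omega

theorem notMem_sporadicTriples (P : Profile q g a₁ a₂) (hn : q ^ 2 < g + a₁ + a₂) :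
    ((g : ℤ), (a₁ : ℤ), (a₂ : ℤ)) ∉ sporadicTriples d := by
  have hb := P.bounds
  rintro ((⟨⟨m, u, v, w⟩, ht, h⟩ | ⟨⟨m, u, v, w⟩, ht, h⟩) | ⟨⟨m, u, v, w⟩, ht, h⟩) <;>
    simp only [Prod.mk.injEq] at h <;>
    have hsum := (sum_of_mem_sporadicPartitions ht).1 <;>
    obtain ⟨hq, hs, hp⟩ := P.eq_of_mem_sporadicPartitions hn ht (by omega) <;>
    obtain ⟨hX, hY, hZ⟩ := hp ▸ P.subset_range (by omega) <;>
    have hsq : q ^ 2 = m ^ 2 + 2 * m + 1 := by rw [hq]; ring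
  · have := lt_oddSum_add_of_mem_sporadicPartitions P.disjoint_XY hX hY ht
      (by omega) (by omega)
    omega
  · have := lt_oddSum_add_of_mem_sporadicPartitions P.disjoint_YZ.symm hZ hY ht
      (by omega) (by omega)
    omega
  · have := lt_oddSum_add_of_mem_sporadicPartitions P.disjoint_YZ hY hZ ht
      (by omega) (by omega)
    omega

theorem notMem_setB (P : Profile q g a₁ a₂) : ((g : ℤ), (a₁ : ℤ), (a₂ : ℤ)) ∉ setB q := by
  intro h
  simp only [setB, Set.mem_insert_iff, Set.mem_singleton_iff, Prod.mk.injEq] at h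
  have hsq := Nat.cast_pow (α := ℤ) q 2
  have := P.bounds
  have hY := oddSum_ne_two (X := P.Y)
  omega

theorem notMem_setC₁ (P : Profile q g a₁ a₂) :
    ((g : ℤ), (a₁ : ℤ), (a₂ : ℤ)) ∉ setC₁ q r := by
  intro h
  simp only [setC₁, Set.mem_insert_iff, Set.mem_singleton_iff, Prod.mk.injEq] at h
  have hsq := Nat.cast_pow (α := ℤ) q 2
  have := P.bounds
  have hX := oddSum_ne_two (X := P.X)
  have hZ := oddSum_ne_two (X := P.Z)
  omega

theorem notMem_setC₂ (P : Profile q g a₁ a₂) : ((g : ℤ), (a₁ : ℤ), (a₂ : ℤ)) ∉ setC₂ q := by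
  intro h
  by_cases hs : P.s + 1 = q
  · exact (setC₂_subset q h).elim (P.notMem_armTriple (.inr hs))
      (P.notMem_cycleTriple (.inr hs))
  have not_canCover : ∀ e ≤ 2, ∀ e' ≤ 2 - e,
      ¬ CanCover 4 (4 - e) (3 - e') (7 - (e + e')) ∧
        ¬ CanCover 4 (4 - e) (4 - e') (8 - (e + e')) := by
    decide +kernel
  simp only [setC₂, Set.mem_insert_iff, Set.mem_singleton_iff, Prod.mk.injEq] at h
  have hsq := Nat.cast_pow (α := ℤ) q 2
  have := P.bounds
  obtain h | h | h := h
  · have := lt_oddSum_add P.disjoint_XY (by omega) (by omega) (by omega)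
      (not_canCover P.e₁ (by omega) P.e₂ (by omega)).1
    omega
  · have := lt_oddSum_add P.disjoint_YZ.symm (by omega) (by omega) (by omega)
      (not_canCover P.e₃ (by omega) P.e₂ (by omega)).1
    omega
  · have := lt_oddSum_add P.disjoint_YZ.symm (by omega) (by omega) (by omega)
      (not_canCover P.e₃ (by omega) P.e₂ (by omega)).2
    omega

theorem notMem_setC₃ (P : Profile q g a₁ a₂) (hn : q ^ 2 < g + a₁ + a₂) :
    ((g : ℤ), (a₁ : ℤ), (a₂ : ℤ)) ∉ setC₃ q := by
  intro h
  obtain (h' | h') | h' := setC₃_subset q h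
  · exact P.notMem_armTriple (.inl le_rfl) h'
  · exact P.notMem_cycleTriple (.inl le_rfl) h'
  · exact P.notMem_sporadicTriples hn h'

theorem notMem_setC₄ (P : Profile q g a₁ a₂) (hn : q ^ 2 < g + a₁ + a₂) :
    ((g : ℤ), (a₁ : ℤ), (a₂ : ℤ)) ∉ setC₄ q := by
  rintro ((⟨h, -, -, ha₂⟩ | h) | h)
  · have hsq := Nat.cast_pow (α := ℤ) q 2
    have := P.bounds
    have hY := oddSum_ne_two (X := P.Y)
    omega
  · exact P.notMem_armTriple (.inl zero_le_one) (setB₁_subset q h)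
  · exact P.notMem_sporadicTriples hn (setB₄_union_subset (.inl (.inl h)))

theorem notMem_setC₅ (P : Profile q g a₁ a₂) (hn : q ^ 2 < g + a₁ + a₂) :
    ((g : ℤ), (a₁ : ℤ), (a₂ : ℤ)) ∉ setC₅ q := by
  rintro ((⟨h, -, -, ha₂⟩ | h) | h)
  · have hsq := Nat.cast_pow (α := ℤ) q 2
    have := P.bounds
    have hY := oddSum_ne_two (X := P.Y)
    omega
  · exact P.notMem_cycleTriple (.inl zero_le_one) (setB₂_subset q h)
  · exact P.notMem_sporadicTriples hn (setB₄_union_subset (.inl (.inr h)))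

theorem notMem_setC₆ (P : Profile q g a₁ a₂) (hn : q ^ 2 < g + a₁ + a₂) :
    ((g : ℤ), (a₁ : ℤ), (a₂ : ℤ)) ∉ setC₆ q := by
  rintro ((⟨h, -, -, hg⟩ | h) | h)
  · have hsq := Nat.cast_pow (α := ℤ) q 2
    have := P.bounds
    have hZ := oddSum_ne_two (X := P.Z)
    omega
  · exact P.notMem_cycleTriple_swap (.inl zero_le_one) (setB₃_subset q h)
  · exact P.notMem_sporadicTriples hn (setB₄_union_subset (.inr h))

end Profile

end Exceptional

theorem ceil_sqrt_eq_succ {n q : ℕ} (h₁ : q ^ 2 < n) (h₂ : n ≤ (q + 1) ^ 2) :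
    ⌈√(n : ℝ)⌉₊ = q + 1 := by
  rw [Nat.ceil_eq_iff q.succ_ne_zero, Nat.succ_sub_one]
  exact ⟨Real.lt_sqrt_of_sq_lt (mod_cast h₁), Real.sqrt_le_iff.2 ⟨by positivity, mod_cast h₂⟩⟩

end GraphBurning

theorem theorem4p10 (q r g a₁ a₂ : ℕ) (hr₁ : 1 ≤ r) (hr₂ : r ≤ 2 * q + 1)
    (hg : 3 ≤ g) (ha₂ : 1 ≤ a₂) (ha : a₂ ≤ a₁) (hn : g + a₁ + a₂ = q ^ 2 + r)
    (h : (r : ℤ) ≥ 2 * q - 1 ∨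
      (3 ≤ g ∧ g ≤ r) ∨
      g ≥ q ^ 2 + 1 ∨
      (a₁ : ℤ) ≥ (q : ℤ) ^ 2 - ((g / 2 : ℕ) : ℤ) ∨
      (2 * q ≤ g ∧ g ≤ q ^ 2 ∧ (a₂ : ℤ) ≤ (r : ℤ) - q) ∨
      ((g : ℤ), (a₁ : ℤ), (a₂ : ℤ)) ∈
        setC₁ q r ∪ setC₂ q ∪ setC₃ q ∪ setC₄ q ∪ setC₅ q ∪ setC₆ q ∪ setB q) :
    burningNumber (twoArmUnicyclic g a₁ a₂) = ⌈√((g + a₁ + a₂ : ℕ) : ℝ)⌉₊ ∧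
      ⌈√((g + a₁ + a₂ : ℕ) : ℝ)⌉₊ = q + 1 := by
  have hlt : q ^ 2 < g + a₁ + a₂ := by omega
  have hle : g + a₁ + a₂ ≤ (q + 1) ^ 2 := by nlinarith only [hn, hr₂]
  have hceil := ceil_sqrt_eq_succ hlt hle
  refine ⟨?_, hceil⟩
  rw [hceil]
  refine burningNumber_eq_succ (fun hburn => ?_) (isBurnable_twoArmUnicyclic hg hle)
  obtain ⟨P⟩ := nonempty_profile hg hburn
  have hsq := Nat.cast_pow (α := ℤ) q 2
  rcases h with h | h | h | h | h | ((((((h | h) | h) | h) | h) | h) | h)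
  · exact absurd P.order_add_two_le (by omega)
  · exact absurd P.arms_lt (by omega)
  · exact absurd P.cycle_le_sq (by omega)
  · exact absurd P.arm_add_half_cycle_lt (by omega)
  · exact absurd P.arm_add_cycle_lt (by omega)
  · exact P.notMem_setC₁ h
  · exact P.notMem_setC₂ h
  · exact P.notMem_setC₃ hlt h
  · exact P.notMem_setC₄ hlt h
  · exact P.notMem_setC₅ hlt h
  · exact P.notMem_setC₆ hlt h
  · exact P.notMem_setB h
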